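/- Let $G$ be a (finite-dimensional, real) Lie group with Lie algebra $\mathfrak g=T_eG$, and let $M$ be a homogeneous $G$-space, that is, a smooth $n$-dimensional manifold (Hausdorff, without boundary) with a smooth transitive left action $G\times M\to M$, $(g,q)\mapsto g.q$. Let $\mu$ be a smooth positive density on $M$, that is, a smooth assignment to each $q\in M$ of a function $\mu_q:(T_qM)^n\to\mathbb R$ with $\mu_q(Tv_1,\dots,Tv_n)=|\det T|\,\mu_q(v_1,\dots,v_n)$ for all linear $T:T_qM\to T_qM$ and $\mu_q(v_1,\dots,v_n)>0$ for linearly independent $v_1,\dots,v_n$. Assume that $\mu$ is $G$-invariant: for every $g\in G$, the pullback of $\mu$ by the map $q\mapsto g.q$ is $\mu$. For $v\in\mathfrak g$ let $\widetilde v$ be the vector field on $M$ given by $$\widetilde v_q=\frac{d}{dt}\Big|_{t=0}\exp(tv).q,\qquad q\in M.$$ Then, for every $v\in\mathfrak g$, the vector field $\widetilde v$ is smooth and its divergence with respect to $\mu$ is zero: $\operatorname{div}_\mu\widetilde v=0$. Here the divergence of a smooth vector field $X$ with respect to $\mu$ is the function $\operatorname{div}_\mu X\in C^\infty(M)$ such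 that $\mathcal L_X\mu=(\operatorname{div}_\mu X)\,\mu$, where $\mathcal L_X\mu=\frac{d}{dt}\big|_{t=0}(\phi_X^t)^*\mu$ is the Lie derivative, $\phi_X^t$ being the flow of $X$. -/

import Mathlib

open Set Module
open scoped Manifold ContDiff

/-! ### Densities -/

/-- A density on an `n`-dimensional real vector space `V`: a function `μ` of `n` vectors with
`μ (T v₁, …, T vₙ) = |det T| μ (v₁, …, vₙ)` for every linear `T : V → V`.
It is only used with `n = dim V`. -/
structure LinearDensity (n : ℕ) (V : Type*) [AddCommGroup V] [Module ℝ V] where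
  toFun : (Fin n → V) → ℝ
  map_linear' : ∀ (T : V →ₗ[ℝ] V) (v : Fin n → V),
    toFun (fun i => T (v i)) = |LinearMap.det T| * toFun v

instance (n : ℕ) (V : Type*) [AddCommGroup V] [Module ℝ V] :
    CoeFun (LinearDensity n V) (fun _ => (Fin n → V) → ℝ) :=
  ⟨LinearDensity.toFun⟩

/-- A (not necessarily continuous) section of the density bundle of `M`: a density on each tangent
space of `M`. -/
def DensityField {E : Type*} [NormedAddCommGroup E] [NormedSpace ℝ E]
    {H : Type*} [TopologicalSpace H] (I : ModelWithCorners ℝ E H)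
    (M : Type*) [TopologicalSpace M] [ChartedSpace H M] : Type _ :=
  ∀ q : M, LinearDensity (finrank ℝ E) (TangentSpace I q)

section

variable {E : Type*} [NormedAddCommGroup E] [NormedSpace ℝ E]
  {H : Type*} [TopologicalSpace H] {I : ModelWithCorners ℝ E H}
  {M : Type*} [TopologicalSpace M] [ChartedSpace H M]

/-- A density field is positive if it is positive on linearly independent tuples. -/
def DensityField.IsPositive (μ : DensityField I M) : Prop :=
  ∀ (q : M) (v : Fin (finrank ℝ E) → TangentSpace I q), LinearIndependent ℝ v → 0 < μ q v

/-- A density field on a manifold without boundary is smooth if, in each chart `φ` with coordinates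
`x₁, …, xₙ`, it reads `f |dx₁ ∧ ⋯ ∧ dxₙ|` with `f` smooth; that is, the pullback of `μ` by `φ⁻¹`,
evaluated on any fixed tuple of vectors of the model space, is a smooth function on the image
of `φ`. -/
def DensityField.IsSmooth (μ : DensityField I M) : Prop :=
  ∀ (x : M) (e : Fin (finrank ℝ E) → E),
    ContDiffOn ℝ ∞
      (fun z : E => μ ((extChartAt I x).symm z)
        (fun i => mfderiv 𝓘(ℝ, E) I (extChartAt I x).symm z (e i)))
      (extChartAt I x).target

/-- The pullback of `μ` by a map `F : M → M`:
`(F^* μ)_q (v₁, …, vₙ) = μ_{F q} (dF_q v₁, …, dF_q vₙ)`. -/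
noncomputable def DensityField.pullback (μ : DensityField I M) (F : M → M) (q : M)
    (v : Fin (finrank ℝ E) → TangentSpace I q) : ℝ :=
  μ (F q) (fun i => mfderiv I I F q (v i))

/-- Invariance of a density field under the action of `G`: the pullback of `μ` by `q ↦ g • q`
is `μ`, for every `g : G`. -/
def DensityField.IsInvariant (G : Type*) [SMul G M] (μ : DensityField I M) : Prop :=
  ∀ (g : G) (q : M) (v : Fin (finrank ℝ E) → TangentSpace I q),
    μ.pullback (fun x => g • x) q v = μ q v

/-! ### Flows, Lie derivative, divergence -/

variable (I) in
open Classical in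
/-- The (maximal) flow of a vector field `X`: `vectorFieldFlow I X t q` is the value at time `t` of
an integral curve of `X` defined on an open interval containing `0` and `t` and starting at `q` at
time `0`. The value is the junk `q` if there is no such curve. For smooth `X` on a Hausdorff manifold
without boundary, the value does not depend on the curve, and for each `q` there is such a curve
for all `t` near `0`. -/
noncomputable def vectorFieldFlow (X : ∀ q : M, TangentSpace I q) (t : ℝ) (q : M) : M :=
  if h : ∃ γ : ℝ → M, γ 0 = q ∧ ∃ a b : ℝ, 0 ∈ Ioo a b ∧ t ∈ Ioo a b ∧
      IsMIntegralCurveOn (I := I) γ X (Ioo a b)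
  then h.choose t else q

/-- `ν` is the Lie derivative of `μ` along `X`: at each point, it is the derivative at `t = 0`
(which is required to exist) of `t ↦ (φ^t)^* μ`, where `φ` is the flow of `X`. -/
def DensityField.IsLieDerivative (μ : DensityField I M) (X : ∀ q : M, TangentSpace I q)
    (ν : ∀ q : M, (Fin (finrank ℝ E) → TangentSpace I q) → ℝ) : Prop :=
  ∀ (q : M) (v : Fin (finrank ℝ E) → TangentSpace I q),
    HasDerivAt (fun t : ℝ => μ.pullback (vectorFieldFlow I X t) q v) (ν q v) 0

/-- `f` is the divergence of the vector field `X` with respect to `μ`: it is a smooth function, and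
the Lie derivative of `μ` along `X` is `f μ`. -/
structure DensityField.IsDivergence (μ : DensityField I M) (X : ∀ q : M, TangentSpace I q)
    (f : M → ℝ) : Prop where
  smooth : ContMDiff I 𝓘(ℝ, ℝ) ∞ f
  isLieDerivative : μ.IsLieDerivative X (fun q v => f q * μ q v)

/-- With respect to a positive density, there is at most one divergence. -/
theorem DensityField.IsDivergence.unique [FiniteDimensional ℝ E] {μ : DensityField I M}
    (hμ : μ.IsPositive) {X : ∀ q : M, TangentSpace I q} {f g : M → ℝ}
    (hf : μ.IsDivergence X f) (hg : μ.IsDivergence X g) : f = g := by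
  funext q
  let b : Fin (finrank ℝ E) → TangentSpace I q := finBasis ℝ E
  have hb : LinearIndependent ℝ b := (finBasis ℝ E).linearIndependent
  exact mul_right_cancel₀ (hμ q b hb).ne'
    ((hf.isLieDerivative q b).unique (hg.isLieDerivative q b))

end

/-! ### The exponential map and fundamental vector fields -/

section

variable {E' : Type*} [NormedAddCommGroup E'] [NormedSpace ℝ E']
  {H' : Type*} [TopologicalSpace H'] (J : ModelWithCorners ℝ E' H')
  {G : Type*} [TopologicalSpace G] [ChartedSpace H' G] [Group G]

/-- `γ` is a one-parameter subgroup of `G` with velocity `v` at time `0`. (A homomorphism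
`ℝ → G` that is differentiable at `0` is smooth.) -/
structure IsOneParameterSubgroup (v : GroupLieAlgebra J G) (γ : ℝ → G) : Prop where
  map_add : ∀ s t : ℝ, γ (s + t) = γ s * γ t
  hasMFDerivAt : HasMFDerivAt 𝓘(ℝ, ℝ) J γ 0 ((1 : ℝ →L[ℝ] ℝ).smulRight v)

open Classical in
/-- The exponential map of a Lie group: `exp v = γ 1`, where `γ` is the one-parameter subgroup
with velocity `v` at time `0`. (It exists and is unique for every `v`; the value `1` in the other
case is junk.) -/
noncomputable def lieExp (v : GroupLieAlgebra J G) : G :=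
  if h : ∃ γ : ℝ → G, IsOneParameterSubgroup J v γ then h.choose 1 else 1

variable {E : Type*} [NormedAddCommGroup E] [NormedSpace ℝ E]
  {H : Type*} [TopologicalSpace H] (I : ModelWithCorners ℝ E H)
  {M : Type*} [TopologicalSpace M] [ChartedSpace H M]

/-- The vector field `q ↦ d/dt|_{t = 0} exp (t v) • q` on `M` associated to an element `v` of the
Lie algebra of `G`. -/
noncomputable def fundamentalVectorField [SMul G M] (v : GroupLieAlgebra J G) (q : M) :
    TangentSpace I q :=
  mfderiv 𝓘(ℝ, ℝ) I (fun t : ℝ => lieExp J (t • v) • q) 0 (1 : ℝ)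

end

section LieGroup

variable {E' : Type*} [NormedAddCommGroup E'] [NormedSpace ℝ E']
  {H' : Type*} [TopologicalSpace H'] {J : ModelWithCorners ℝ E' H'}
  {G : Type*} [TopologicalSpace G] [ChartedSpace H' G] [Group G]

theorem mulInvariantVectorField_apply_one (v : GroupLieAlgebra J G) :
    mulInvariantVectorField v (1 : G) = v := by
  have h : (fun x : G => 1 * x) = id := by ext; simp
  unfold mulInvariantVectorField
  rw [h, mfderiv_id]
  rfl

theorem IsOneParameterSubgroup.map_zero {v : GroupLieAlgebra J G} {γ : ℝ → G}
    (hγ : IsOneParameterSubgroup J v γ) : γ 0 = 1 := by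
  simpa using hγ.map_add 0 0

theorem IsOneParameterSubgroup.comp_mul_const {v : GroupLieAlgebra J G} {γ : ℝ → G}
    (hγ : IsOneParameterSubgroup J v γ) (c : ℝ) :
    IsOneParameterSubgroup J (c • v) (fun t => γ (t * c)) where
  map_add s t := by rw [add_mul, hγ.map_add]
  hasMFDerivAt := by
    have h0 : HasMFDerivAt 𝓘(ℝ, ℝ) J γ (0 * c) ((1 : ℝ →L[ℝ] ℝ).smulRight v) := by
      rw [zero_mul]; exact hγ.hasMFDerivAt
    have hc := HasMFDerivAt.comp (f := fun s : ℝ => s * c) 0 h0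
      ((hasFDerivAt_id (0 : ℝ)).mul_const c).hasMFDerivAt
    refine hc.congr_mfderiv ?_
    refine ContinuousLinearMap.ext_ring ?_
    change (c * (1 : ℝ)) • (v : E') = (1 : ℝ) • c • (v : E')
    rw [mul_one, one_smul]

theorem contMDiff_smul_const
    {E : Type*} [NormedAddCommGroup E] [NormedSpace ℝ E]
    {H : Type*} [TopologicalSpace H] {I : ModelWithCorners ℝ E H}
    {M : Type*} [TopologicalSpace M] [ChartedSpace H M] [MulAction G M]
    [ContMDiffSMul J I ∞ G M] (q : M) : ContMDiff J I ∞ (fun g : G => g • q) :=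
  (ContMDiffSMul.contMDiff_smul (I := J) (I' := I) (n := ∞) (G := G) (M := M)).comp
    (contMDiff_id.prodMk contMDiff_const)

theorem IsOneParameterSubgroup.hasMFDerivAt_smul
    {E : Type*} [NormedAddCommGroup E] [NormedSpace ℝ E]
    {H : Type*} [TopologicalSpace H] {I : ModelWithCorners ℝ E H}
    {M : Type*} [TopologicalSpace M] [ChartedSpace H M] [MulAction G M]
    [ContMDiffSMul J I ∞ G M] {v : GroupLieAlgebra J G} {γ : ℝ → G}
    (hγ : IsOneParameterSubgroup J v γ) (q : M) :
    HasMFDerivAt 𝓘(ℝ, ℝ) I (fun t : ℝ => γ t • q) 0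
      ((1 : ℝ →L[ℝ] ℝ).smulRight (mfderiv J I (fun g : G => g • q) 1 v : E)) := by
  have hd : HasMFDerivAt J I (fun g : G => g • q) (γ 0)
      (mfderiv J I (fun g : G => g • q) (1 : G)) := by
    rw [hγ.map_zero]
    exact ((contMDiff_smul_const (J := J) (I := I) q).mdifferentiableAt (by simp)).hasMFDerivAt
  refine (hd.comp 0 hγ.hasMFDerivAt).congr_mfderiv ?_
  refine ContinuousLinearMap.ext_ring ?_
  change mfderiv J I (fun g : G => g • q) (1 : G) ((1 : ℝ) • v) =
    (1 : ℝ) • mfderiv J I (fun g : G => g • q) (1 : G) v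
  rw [map_smul]

variable [LieGroup J ∞ G]

/-- Left translation maps an invariant vector field to itself. -/
theorem mfderiv_mul_left_mulInvariantVectorField (v : GroupLieAlgebra J G) (g h : G) :
    mfderiv J J (fun x : G => g * x) h (mulInvariantVectorField v h) =
      mulInvariantVectorField v (g * h) := by
  have hd : ∀ a b : G, MDifferentiableAt J J (fun x : G => a * x) b := fun a b =>
    (contMDiff_mul_left (I := J) (n := ∞) (a := a)).mdifferentiableAt (by simp)
  have hc : (fun x : G => g * h * x) = (fun x => g * x) ∘ (fun x => h * x) := by
    ext x; simp [mul_assoc]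
  have key : mfderiv J J (fun x : G => g * h * x) 1 =
      (mfderiv J J (fun x : G => g * x) (h * 1)).comp (mfderiv J J (fun x : G => h * x) 1) := by
    rw [hc]
    exact mfderiv_comp (I' := J) (1 : G) (hd g (h * 1)) (hd h 1)
  unfold mulInvariantVectorField
  rw [key, mul_one]
  rfl

theorem contMDiff_one_mulInvariantVectorField (v : GroupLieAlgebra J G) :
    ContMDiff J J.tangent 1
      (fun g : G => (⟨g, mulInvariantVectorField v g⟩ : TangentBundle J G)) := by
  have : LieGroup J (minSmoothness ℝ 3) G :=
    LieGroup.of_le (n := ∞) (by simpa using ENat.LEInfty.out)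
  exact (contMDiff_mulInvariantVectorField v).of_le (by simp)

/-- Left translates of integral curves of an invariant vector field are integral curves. -/
theorem IsMIntegralCurveOn.const_mul {v : GroupLieAlgebra J G} {γ : ℝ → G} {s : Set ℝ}
    (hγ : IsMIntegralCurveOn γ (mulInvariantVectorField v) s) (g : G) :
    IsMIntegralCurveOn (fun t => g * γ t) (mulInvariantVectorField v) s := by
  intro t ht
  have hd : HasMFDerivAt J J (fun x : G => g * x) (γ t) _ :=
    ((contMDiff_mul_left (I := J) (n := ∞) (a := g)).mdifferentiableAt (by simp)).hasMFDerivAt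
  refine (hd.comp_hasMFDerivWithinAt t (hγ t ht)).congr_mfderiv ?_
  refine ContinuousLinearMap.ext_ring ?_
  have := mfderiv_mul_left_mulInvariantVectorField v g (γ t)
  change mfderiv J J (fun x : G => g * x) (γ t) ((1 : ℝ) • mulInvariantVectorField v (γ t)) =
    (1 : ℝ) • mulInvariantVectorField v (g * γ t)
  rw [one_smul, one_smul, this]

theorem IsMIntegralCurve.const_mul {v : GroupLieAlgebra J G} {γ : ℝ → G}
    (hγ : IsMIntegralCurve γ (mulInvariantVectorField v)) (g : G) :
    IsMIntegralCurve (fun t => g * γ t) (mulInvariantVectorField v) := by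
  rw [isMIntegralCurve_iff_isMIntegralCurveOn] at *
  exact hγ.const_mul g

/-- A one-parameter subgroup is an integral curve of the invariant vector field. -/
theorem IsOneParameterSubgroup.isMIntegralCurve {v : GroupLieAlgebra J G} {γ : ℝ → G}
    (hγ : IsOneParameterSubgroup J v γ) : IsMIntegralCurve γ (mulInvariantVectorField v) := by
  intro t
  have hd : HasMFDerivAt J J (fun x : G => γ t * x) (γ (t - t))
      (mfderiv J J (fun x : G => γ t * x) (1 : G)) := by
    rw [sub_self, hγ.map_zero]
    exact ((contMDiff_mul_left (I := J) (n := ∞) (a := γ t)).mdifferentiableAt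
      (by simp)).hasMFDerivAt
  have h0 : HasMFDerivAt 𝓘(ℝ, ℝ) J γ (t - t) ((1 : ℝ →L[ℝ] ℝ).smulRight v) := by
    rw [sub_self]; exact hγ.hasMFDerivAt
  have hc := hd.comp t (HasMFDerivAt.comp (f := fun s : ℝ => s - t) t h0
    ((hasFDerivAt_id t).sub_const t).hasMFDerivAt)
  have he : (fun x : G => γ t * x) ∘ γ ∘ (fun s : ℝ => s - t) = γ := by
    ext s; simp [← hγ.map_add]
  rw [he] at hc
  refine hc.congr_mfderiv ?_
  refine ContinuousLinearMap.ext_ring ?_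
  change mfderiv J J (fun x : G => γ t * x) (1 : G) ((1 : ℝ) • v) =
    (1 : ℝ) • mfderiv J J (fun x : G => γ t * x) (1 : G) v
  rw [map_smul]

/-- A one-parameter subgroup is determined by its velocity. -/
theorem IsOneParameterSubgroup.unique [BoundarylessManifold J G] [T2Space G]
    {v : GroupLieAlgebra J G} {γ γ' : ℝ → G}
    (hγ : IsOneParameterSubgroup J v γ) (hγ' : IsOneParameterSubgroup J v γ') : γ = γ' :=
  isMIntegralCurve_Ioo_eq_of_contMDiff_boundaryless (t₀ := 0)
    (contMDiff_one_mulInvariantVectorField v) hγ.isMIntegralCurve hγ'.isMIntegralCurve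
    (by rw [hγ.map_zero, hγ'.map_zero])

theorem IsOneParameterSubgroup.lieExp_smul [BoundarylessManifold J G] [T2Space G]
    {v : GroupLieAlgebra J G} {γ : ℝ → G}
    (hγ : IsOneParameterSubgroup J v γ) (t : ℝ) : lieExp J (t • v) = γ t := by
  have ht := hγ.comp_mul_const t
  have h : ∃ γ : ℝ → G, IsOneParameterSubgroup J (t • v) γ := ⟨_, ht⟩
  rw [lieExp, dif_pos h, h.choose_spec.unique ht]
  exact congrArg γ (one_mul t)

section Complete

variable [CompleteSpace E'] [BoundarylessManifold J G] [T2Space G]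

/-- Invariant vector fields are complete. -/
theorem exists_isMIntegralCurve_mulInvariantVectorField (v : GroupLieAlgebra J G) :
    ∃ γ : ℝ → G, γ 0 = 1 ∧ IsMIntegralCurve γ (mulInvariantVectorField v) := by
  have hv := contMDiff_one_mulInvariantVectorField v
  obtain ⟨γ, h0, hγ⟩ := exists_isMIntegralCurveAt_of_contMDiffAt_boundaryless (I := J) 0
    (hv.contMDiffAt (x := (1 : G)))
  obtain ⟨ε, hε, hγ⟩ := isMIntegralCurveAt_iff'.1 hγ
  rw [Real.ball_eq_Ioo, zero_sub, zero_add] at hγ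
  exact exists_isMIntegralCurve_of_isMIntegralCurveOn hv hε
    (fun g => ⟨fun t => g * γ t, by simp [h0], hγ.const_mul g⟩) 1

/-- Every element of the Lie algebra is the velocity of a one-parameter subgroup. -/
theorem exists_isOneParameterSubgroup (v : GroupLieAlgebra J G) :
    ∃ γ : ℝ → G, IsOneParameterSubgroup J v γ := by
  obtain ⟨γ, h0, hγ⟩ := exists_isMIntegralCurve_mulInvariantVectorField v
  refine ⟨γ, fun s t => ?_, ?_⟩
  · have h := isMIntegralCurve_Ioo_eq_of_contMDiff_boundaryless (t₀ := 0)
      (contMDiff_one_mulInvariantVectorField v) (hγ.comp_add s) (hγ.const_mul (γ s)) (by simp [h0])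
    have := congrFun h t
    simpa [add_comm] using this
  · have h := hγ 0
    have hv : mulInvariantVectorField v (γ 0) = (v : E') := by
      rw [h0]; exact mulInvariantVectorField_apply_one v
    refine h.congr_mfderiv ?_
    refine ContinuousLinearMap.ext_ring ?_
    change (1 : ℝ) • (mulInvariantVectorField v (γ 0) : E') = (1 : ℝ) • (v : E')
    exact congrArg _ hv

end Complete

section Action

variable {E : Type*} [NormedAddCommGroup E] [NormedSpace ℝ E]
  {H : Type*} [TopologicalSpace H] {I : ModelWithCorners ℝ E H}
  {M : Type*} [TopologicalSpace M] [ChartedSpace H M] [MulAction G M]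
  [ContMDiffSMul J I ∞ G M] [CompleteSpace E'] [BoundarylessManifold J G] [T2Space G]

/-- The fundamental vector field of `v` at `q` is the image of `v` under the derivative of the
orbit map `g ↦ g • q`. -/
theorem fundamentalVectorField_eq_mfderiv (v : GroupLieAlgebra J G) (q : M) :
    (fundamentalVectorField J I v q : E) = mfderiv J I (fun g : G => g • q) 1 v := by
  obtain ⟨γ, hγ⟩ := exists_isOneParameterSubgroup v
  have h : (fun t : ℝ => lieExp J (t • v) • q) = fun t => γ t • q := by
    funext t; rw [hγ.lieExp_smul]
  unfold fundamentalVectorField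
  rw [h, (hγ.hasMFDerivAt_smul (I := I) q).mfderiv]
  exact one_smul ℝ (mfderiv J I (fun g : G => g • q) 1 v : E)

/-- Orbits of one-parameter subgroups are integral curves of fundamental vector fields. -/
theorem IsOneParameterSubgroup.isMIntegralCurve_smul {v : GroupLieAlgebra J G} {γ : ℝ → G}
    (hγ : IsOneParameterSubgroup J v γ) (q : M) :
    IsMIntegralCurve (fun t => γ t • q) (fundamentalVectorField J I v) := by
  intro t
  have h0 : HasMFDerivAt 𝓘(ℝ, ℝ) I (fun s : ℝ => γ s • γ t • q) (t - t)
      ((1 : ℝ →L[ℝ] ℝ).smulRight (fundamentalVectorField J I v (γ t • q) : E)) := by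
    rw [sub_self, fundamentalVectorField_eq_mfderiv]
    exact hγ.hasMFDerivAt_smul (γ t • q)
  have hc := HasMFDerivAt.comp (f := fun s : ℝ => s - t) t h0
    ((hasFDerivAt_id t).sub_const t).hasMFDerivAt
  have he : (fun s : ℝ => γ s • γ t • q) ∘ (fun s : ℝ => s - t) = fun s => γ s • q := by
    ext s; simp [← mul_smul, ← hγ.map_add]
  rw [he] at hc
  exact hc

variable [IsManifold I ∞ M]

theorem contMDiff_fundamentalVectorField (v : GroupLieAlgebra J G) :
    ContMDiff I I.tangent ∞
      (fun q : M => (⟨q, fundamentalVectorField J I v q⟩ : TangentBundle I M)) := by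
  have hs := ContMDiffSMul.contMDiff_smul (I := J) (I' := I) (n := ∞) (G := G) (M := M)
  have h₁ : ContMDiff I (J.tangent.prod I.tangent) ∞
      (fun q : M => ((⟨1, v⟩, ⟨q, 0⟩) : TangentBundle J G × TangentBundle I M)) :=
    contMDiff_const.prodMk (Bundle.contMDiff_zeroSection ℝ (TangentSpace I : M → Type _))
  have h₂ : ContMDiff (J.tangent.prod I.tangent) (J.prod I).tangent ∞
      (equivTangentBundleProd J G I M).symm := contMDiff_equivTangentBundleProd_symm
  have h₃ : ContMDiff (J.prod I).tangent I.tangent ∞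
      (tangentMap (J.prod I) I (fun p : G × M => p.1 • p.2)) :=
    hs.contMDiff_tangentMap (by simp)
  convert! (h₃.comp h₂).comp h₁ with q
  · simp
  · simp only [Function.comp_apply, tangentMap]
    rw [mfderiv_prod_eq_add_apply (hs.mdifferentiableAt (by simp))]
    have := fundamentalVectorField_eq_mfderiv (I := I) v q
    refine this.trans (Eq.symm ?_)
    let a : E := mfderiv J I (fun g : G => g • q) 1 v
    exact (congrArg (fun w : E => a + w)
      (map_zero (mfderiv I I (fun x : M => (1 : G) • x) q))).trans (add_zero _)

/-- The flow of a fundamental vector field is the action of the one-parameter subgroup. -/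
theorem IsOneParameterSubgroup.vectorFieldFlow_eq [BoundarylessManifold I M] [T2Space M]
    {v : GroupLieAlgebra J G} {γ : ℝ → G} (hγ : IsOneParameterSubgroup J v γ) (t : ℝ) :
    vectorFieldFlow I (fundamentalVectorField J I v) t = fun q : M => γ t • q := by
  funext q
  have hq := hγ.isMIntegralCurve_smul (I := I) q
  have h : ∃ σ : ℝ → M, σ 0 = q ∧ ∃ a b : ℝ, 0 ∈ Ioo a b ∧ t ∈ Ioo a b ∧
      IsMIntegralCurveOn (I := I) σ (fundamentalVectorField J I v) (Ioo a b) := by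
    refine ⟨_, by simp [hγ.map_zero], -(|t| + 1), |t| + 1, ⟨?_, ?_⟩, abs_lt.1 (lt_add_one _),
      hq.isMIntegralCurveOn _⟩
    · have := abs_nonneg t; linarith
    · positivity
  obtain ⟨h0, a, b, h0ab, htab, hσ⟩ := h.choose_spec
  rw [vectorFieldFlow, dif_pos h]
  have hX : ContMDiff I I.tangent 1
      (fun q : M => (⟨q, fundamentalVectorField J I v q⟩ : TangentBundle I M)) :=
    (contMDiff_fundamentalVectorField v).of_le (by simp)
  exact isMIntegralCurveOn_Ioo_eqOn_of_contMDiff_boundaryless h0ab hX hσ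
    (hq.isMIntegralCurveOn _) (by rw [h0]; simp [hγ.map_zero]) htab

end Action

end LieGroup

theorem mainTheorem6
    {E' : Type*} [NormedAddCommGroup E'] [NormedSpace ℝ E'] [FiniteDimensional ℝ E']
    {H' : Type*} [TopologicalSpace H'] (J : ModelWithCorners ℝ E' H') [J.Boundaryless]
    {G : Type*} [TopologicalSpace G] [ChartedSpace H' G] [T2Space G]
    [Group G] [LieGroup J ∞ G]
    {E : Type*} [NormedAddCommGroup E] [NormedSpace ℝ E] [FiniteDimensional ℝ E]
    {H : Type*} [TopologicalSpace H] (I : ModelWithCorners ℝ E H) [I.Boundaryless]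
    {M : Type*} [TopologicalSpace M] [ChartedSpace H M] [T2Space M] [IsManifold I ∞ M]
    [MulAction G M] [ContMDiffSMul J I ∞ G M] [MulAction.IsPretransitive G M]
    (μ : DensityField I M) (hμ_smooth : μ.IsSmooth) (hμ_pos : μ.IsPositive)
    (hμ_inv : μ.IsInvariant G) (v : GroupLieAlgebra J G) :
    ContMDiff I I.tangent ∞
      (fun q : M => (⟨q, fundamentalVectorField J I v q⟩ : TangentBundle I M)) ∧
    μ.IsDivergence (fundamentalVectorField J I v) (fun _ => 0) := by
  have : CompleteSpace E' := FiniteDimensional.complete ℝ E'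
  refine ⟨contMDiff_fundamentalVectorField v, contMDiff_const, fun q w => ?_⟩
  obtain ⟨γ, hγ⟩ := exists_isOneParameterSubgroup v
  have h : (fun t : ℝ => μ.pullback (vectorFieldFlow I (fundamentalVectorField J I v) t) q w) =
      fun _ => μ q w := by
    funext t
    rw [hγ.vectorFieldFlow_eq]
    exact hμ_inv (γ t) q w
  rw [h]
  exact (hasDerivAt_const 0 (μ q w)).congr_deriv (zero_mul _).symm
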